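/- For every number of agents $A$ let $X^{(A)}=(X^{(A)}_1(n),\dots,X^{(A)}_A(n))_{n\ge 0}$ be the classical linear Pólya urn with $A$ agents started from one unit each, i.e. the discrete-time Markov chain with $X^{(A)}_i(0)=1$ for all $i$ which at each step moves from a configuration $c\in\{1,2,\dots\}^A$ to $c+e^{(i)}$ (with $e^{(i)}$ the $i$-th unit vector) with probability $c_i/(c_1+\dots+c_A)$, $i=1,\dots,A$. Let $\chi^{(A)}_i(n)=X^{(A)}_i(n)/\sum_{j=1}^A X^{(A)}_j(n)$ be the share of agent $i$ at time $n$. Then almost surely the limits $\chi^{(A)}_i(\infty)=\lim_{n\to\infty}\chi^{(A)}_i(n)\in[0,1]$ exist for all $i=1,\dots,A$, and the following holds. 1. For all $A_0\in\mathbb N$ and all $x_1,\dots,x_{A_0}>0$, $$\mathbb P\left(A\,\chi^{(A)}_1(\infty)\le x_1,\dots,A\,\chi^{(A)}_{A_0}(\infty)\le x_{A_0}\right)\xrightarrow{A\to\infty}\prod_{i=1}^{A_0}\left(1-e^{-x_i}\right).$$ 2. $$\frac{A}{\log A}\max_{i=1,\dots,A}\chi^{(A)}_i(\infty)\xrightarrow{A\to\infty}1\quad\text{in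 distribution.}$$ 3. $$\sup_{x\ge 0}\left|\frac1A\sum_{i=1}^A \mathbf 1_{\{A\chi^{(A)}_i(\infty)>x\}}-e^{-x}\right|\xrightarrow{A\to\infty}0\quad\text{in distribution.}$$ -/

import Mathlib

open MeasureTheory ProbabilityTheory Filter Topology

/-- `X` is a generalized Pólya urn with `A` agents, feedback functions `F i`, and initial
configuration `x₀`, defined on the probability space `(Ω, P)`: a discrete-time Markov chain, started
in `x₀`, which from the configuration `c` moves to `c + e_i` with probability
`F i (c i) / ∑ j, F j (c j)`. Agents are numbered `0, …, A - 1`. The Markov property and the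
transition probabilities are expressed by conditioning on the whole past, i.e. on each path
`c 0, …, c n` of positive probability. -/
structure IsPolyaUrn {Ω : Type*} [MeasurableSpace Ω] (P : Measure Ω) {A : ℕ}
    (F : Fin A → ℕ → ℝ) (x₀ : Fin A → ℕ) (X : ℕ → Ω → Fin A → ℕ) : Prop where
  measurable : ∀ n, Measurable (X n)
  initial : ∀ᵐ ω ∂P, X 0 ω = x₀
  transition : ∀ (n : ℕ) (c : ℕ → Fin A → ℕ), P {ω | ∀ k ≤ n, X k ω = c k} ≠ 0 →
    ∀ i : Fin A,
      P[{ω | X (n + 1) ω = c n + Pi.single i 1} | {ω | ∀ k ≤ n, X k ω = c k}] =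
        ENNReal.ofReal (F i (c n i) / ∑ j, F j (c n j))

/-- The share `χ_i(n) = X_i(n) / ∑ j, X_j(n)` of agent `i` at time `n`. -/
noncomputable def share {Ω : Type*} {A : ℕ} (X : ℕ → Ω → Fin A → ℕ) (i : Fin A) (n : ℕ) (ω : Ω) :
    ℝ :=
  (X n ω i : ℝ) / ∑ j, (X n ω j : ℝ)

/-- The long-time share `χ_i(∞) = lim_{n → ∞} χ_i(n)` of agent `i`. -/
noncomputable def limitShare {Ω : Type*} {A : ℕ} (X : ℕ → Ω → Fin A → ℕ) (i : Fin A) (ω : Ω) : ℝ :=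
  limUnder atTop (fun n => share X i n ω)

/-! With linear feedback and unit initial state, all configurations with positive entries and total
`n + A` are equally likely at time `n` (`measureReal_eq_config`). Each share is a bounded
martingale, so it converges almost surely. Counting configurations and letting `n → ∞` shows that
the limit shares are uniform on the simplex, in the form of an explicit joint tail: all agents in
`S` exceed their thresholds `t i` with probability `(1 - ∑ i ∈ S, t i) ^ (A - 1)`
(`measureReal_forall_lt_limitShare`).

All three limits follow from this formula. With `t i = x i / A` the joint tails tend to products of
exponentials, and inclusion-exclusion gives claim 1. For claims 2 and 3, the number of agents above
`t` has mean `A (1 - t) ^ (A - 1)`. Since `1 - 2t ≤ (1 - t)²`, exceedances are nonpositively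
correlated, so the variance is at most the mean and Chebyshev's inequality applies. At `t = x / A`
the mean is about `A e^{-x}`, and monotonicity upgrades pointwise to uniform convergence. At `t = a
log A / A` it is about `A^{1-a}`, which tends to `0` for `a > 1` and to infinity for `a < 1`: the
maximum sits at `a = 1`. -/

namespace IsPolyaUrn

/-- The first `n + 1` states of a process. -/
def history {Ω S : Type*} (X : ℕ → Ω → S) (n : ℕ) (ω : Ω) : Fin (n + 1) → S := fun k => X k ω

/-- The event that agent `i` wins the step from time `n` to time `n + 1`. -/
def stepEvent {Ω : Type*} {A : ℕ} (X : ℕ → Ω → Fin A → ℕ) (n : ℕ) (i : Fin A) : Set Ω :=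
  {ω | X (n + 1) ω = X n ω + Pi.single i 1}

/-! ### One-step transitions given the whole past -/

section General

variable {Ω : Type*} [MeasurableSpace Ω] {P : Measure Ω} {A : ℕ} {F : Fin A → ℕ → ℝ}
  {x₀ : Fin A → ℕ} {X : ℕ → Ω → Fin A → ℕ}

theorem measurable_history (hX : IsPolyaUrn P F x₀ X) (n : ℕ) : Measurable (history X n) :=
  measurable_pi_lambda _ fun k => hX.measurable k

theorem measurableSet_stepEvent (hX : IsPolyaUrn P F x₀ X) (n : ℕ) (i : Fin A) :
    MeasurableSet (stepEvent X n i) :=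
  measurableSet_eq_fun (hX.measurable _) ((hX.measurable n).add_const _)

/-- The path space is countable, so it suffices to compare singletons. There the claim is the
transition rule, or `0 = 0` for a path of probability zero. -/
theorem map_restrict_stepEvent [IsProbabilityMeasure P] (hX : IsPolyaUrn P F x₀ X) (n : ℕ)
    (i : Fin A) :
    (P.restrict (stepEvent X n i)).map (history X n) =
      (P.map (history X n)).withDensity fun c =>
        ENNReal.ofReal (F i (c (Fin.last n) i) / ∑ j, F j (c (Fin.last n) j)) := by
  refine Measure.ext_of_singleton fun c => ?_
  rw [Measure.map_apply (hX.measurable_history n) (measurableSet_singleton c),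
    Measure.restrict_apply (hX.measurable_history n (measurableSet_singleton c)),
    withDensity_apply _ (measurableSet_singleton c), lintegral_singleton,
    Measure.map_apply (hX.measurable_history n) (measurableSet_singleton c)]
  -- The transition rule speaks of paths indexed by all of `ℕ`; the values after time `n` are
  -- irrelevant.
  set c' : ℕ → Fin A → ℕ := fun k => if h : k < n + 1 then c ⟨k, h⟩ else 0 with hc'
  have hpath : history X n ⁻¹' {c} = {ω | ∀ k ≤ n, X k ω = c' k} := by
    ext ω
    simp only [Set.mem_preimage, Set.mem_singleton_iff, Set.mem_ofPred_eq, funext_iff (f := history X n ω)]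
    constructor
    · intro h k hk
      have := h ⟨k, by omega⟩
      simpa [hc', history, hk] using this
    · intro h k
      have := h k (by omega)
      simpa [hc', history, Nat.le_of_lt_succ k.2] using this
  have hlast : c' n = c (Fin.last n) := by
    simp only [hc', Nat.lt_succ_self, dite_true]; rfl
  by_cases h0 : P {ω | ∀ k ≤ n, X k ω = c' k} = 0
  · rw [hpath, h0, mul_zero]
    exact measure_mono_null Set.inter_subset_left h0
  · have hmeas : MeasurableSet {ω | ∀ k ≤ n, X k ω = c' k} :=
      hpath ▸ hX.measurable_history n (measurableSet_singleton c)
    have ht := hX.transition n c' h0 i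
    rw [hpath, ← hlast, ← ht, cond_mul_eq_inter hmeas]
    congr 1
    ext ω
    simp only [Set.mem_inter_iff, Set.mem_ofPred_eq, stepEvent]
    constructor
    · rintro ⟨h1, h2⟩
      exact ⟨h1, by rw [h2, h1 n le_rfl]⟩
    · rintro ⟨h1, h2⟩
      exact ⟨h1, by rw [h2, h1 n le_rfl]⟩

end General

end IsPolyaUrn

/-! ### The linear urn: martingale property and existence of the limit shares -/

namespace IsPolyaUrn

section Linear

variable {Ω : Type*} [MeasurableSpace Ω] {P : Measure Ω} [IsProbabilityMeasure P] {A : ℕ}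
  {X : ℕ → Ω → Fin A → ℕ}

theorem measurable_share (hX : ∀ n, Measurable (X n)) (i : Fin A) (n : ℕ) :
    Measurable (share X i n) := by
  have h : ∀ j, Measurable fun ω => (X n ω j : ℝ) := fun j =>
    (measurable_of_countable (fun k : ℕ => (k : ℝ))).comp ((measurable_pi_apply j).comp (hX n))
  exact (h i).div (Finset.measurable_sum _ fun j _ => h j)

omit [MeasurableSpace Ω] in
theorem share_nonneg (X : ℕ → Ω → Fin A → ℕ) (i : Fin A) (n : ℕ) (ω : Ω) : 0 ≤ share X i n ω := by
  unfold share; positivity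

omit [MeasurableSpace Ω] in
theorem share_le_one (X : ℕ → Ω → Fin A → ℕ) (i : Fin A) (n : ℕ) (ω : Ω) : share X i n ω ≤ 1 := by
  unfold share
  exact div_le_one_of_le₀
    (Finset.single_le_sum (f := fun j => (X n ω j : ℝ)) (fun j _ => by positivity)
      (Finset.mem_univ i)) (by positivity)

theorem integrable_of_abs_le_one {f : Ω → ℝ} (hf : Measurable f) (h : ∀ ω, |f ω| ≤ 1) :
    Integrable f P :=
  Integrable.of_bound hf.aestronglyMeasurable 1 (Eventually.of_forall h)

theorem integrable_share (hX : ∀ n, Measurable (X n)) (i : Fin A) (n : ℕ) :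
    Integrable (share X i n) P :=
  integrable_of_abs_le_one (measurable_share hX i n) fun ω => by
    rw [abs_of_nonneg (share_nonneg X i n ω)]; exact share_le_one X i n ω

theorem setIntegral_stepEvent (hX : IsPolyaUrn P (fun (_ : Fin A) (k : ℕ) => (k : ℝ)) (fun _ => 1) X)
    (n : ℕ) (i : Fin A) (f : (Fin (n + 1) → Fin A → ℕ) → ℝ) :
    ∫ ω in stepEvent X n i, f (history X n ω) ∂P = ∫ ω, share X i n ω * f (history X n ω) ∂P := by
  have hH := hX.measurable_history n
  have hf : Measurable f := measurable_of_countable f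
  rw [← integral_map (f := f) hH.aemeasurable hf.aestronglyMeasurable,
    hX.map_restrict_stepEvent n i,
    integral_withDensity_eq_integral_toReal_smul (measurable_of_countable _)
      (Eventually.of_forall fun _ => ENNReal.ofReal_lt_top),
    integral_map hH.aemeasurable (measurable_of_countable _).aestronglyMeasurable]
  refine integral_congr_ae (Eventually.of_forall fun ω => ?_)
  simp only [smul_eq_mul]
  rw [ENNReal.toReal_ofReal (by positivity)]
  rfl

omit [MeasurableSpace Ω] in
theorem pairwise_disjoint_stepEvent (X : ℕ → Ω → Fin A → ℕ) (n : ℕ) :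
    Pairwise (Function.onFun Disjoint (stepEvent X n)) := by
  intro i j hij
  refine Set.disjoint_left.2 fun ω hi hj => hij ?_
  have h : X n ω + Pi.single i 1 = X n ω + Pi.single j 1 := hi.symm.trans hj
  have h' := congrFun (add_left_cancel h) i
  by_contra hne
  simp [hne] at h'

/-- The step events are disjoint and their probabilities are the expected shares, which sum to `1`
provided the total is almost surely nonzero. -/
theorem ae_mem_stepEvent (hX : IsPolyaUrn P (fun (_ : Fin A) (k : ℕ) => (k : ℝ)) (fun _ => 1) X)
    (n : ℕ) (hpos : ∀ᵐ ω ∂P, ∑ j, X n ω j ≠ 0) : ∀ᵐ ω ∂P, ω ∈ ⋃ i, stepEvent X n i := by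
  have hm := hX.measurableSet_stepEvent n
  have h1 : P.real (⋃ i, stepEvent X n i) = 1 := by
    rw [measureReal_iUnion_fintype (pairwise_disjoint_stepEvent X n) hm]
    have h2 : ∀ i, P.real (stepEvent X n i) = ∫ ω, share X i n ω ∂P := fun i => by
      have := hX.setIntegral_stepEvent n i fun _ => 1
      simpa using this
    simp_rw [h2]
    rw [← integral_finsetSum _ fun i _ => integrable_share hX.measurable i n]
    have h3 : ∀ᵐ ω ∂P, ∑ i, share X i n ω = 1 := by
      filter_upwards [hpos] with ω hω
      unfold share
      rw [← Finset.sum_div]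
      exact div_self (by exact_mod_cast hω)
    rw [integral_congr_ae h3]; simp
  exact (mem_ae_iff_prob_eq_one (MeasurableSet.iUnion hm)).2 ((ENNReal.toReal_eq_one_iff _).1 h1)

theorem ae_one_le_and_sum_eq
    (hX : IsPolyaUrn P (fun (_ : Fin A) (k : ℕ) => (k : ℝ)) (fun _ => 1) X) (hA : 0 < A) (n : ℕ) :
    ∀ᵐ ω ∂P, (∀ i, 1 ≤ X n ω i) ∧ ∑ i, X n ω i = n + A := by
  induction n with
  | zero =>
    filter_upwards [hX.initial] with ω hω
    simp [hω]
  | succ n ih =>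
    filter_upwards [ih, hX.ae_mem_stepEvent n (ih.mono fun ω h => by omega)] with ω h1 h2
    obtain ⟨i, hi⟩ := Set.mem_iUnion.1 h2
    have hi' : X (n + 1) ω = X n ω + Pi.single i 1 := hi
    rw [hi']
    refine ⟨fun j => (h1.1 j).trans (Nat.le_add_right _ _), ?_⟩
    simp only [Pi.add_apply, Finset.sum_add_distrib, h1.2, Finset.mem_univ,
      if_true, Pi.single_apply, Finset.sum_ite_eq']
    omega

/-- Splits the space according to the winner of the step. Taking `f` an indicator of the past gives
the martingale property; taking `f = 1` gives the recursion for the law of the configuration. -/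
theorem integral_mul_history_succ
    (hX : IsPolyaUrn P (fun (_ : Fin A) (k : ℕ) => (k : ℝ)) (fun _ => 1) X) (hA : 0 < A) (n : ℕ)
    (g : (Fin A → ℕ) → ℝ) (f : (Fin (n + 1) → Fin A → ℕ) → ℝ)
    (hg : ∀ c, |g c| ≤ 1) (hf : ∀ c, |f c| ≤ 1) :
    ∫ ω, g (X (n + 1) ω) * f (history X n ω) ∂P =
      ∑ i, ∫ ω, share X i n ω * (g (X n ω + Pi.single i 1) * f (history X n ω)) ∂P := by
  have hm := hX.measurableSet_stepEvent n
  have hint : Integrable (fun ω => g (X (n + 1) ω) * f (history X n ω)) P := by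
    refine integrable_of_abs_le_one (((measurable_of_countable g).comp (hX.measurable _)).mul
      ((measurable_of_countable f).comp (hX.measurable_history n))) fun ω => ?_
    rw [abs_mul]
    exact mul_le_one₀ (hg _) (abs_nonneg _) (hf _)
  have hae := hX.ae_mem_stepEvent n ((hX.ae_one_le_and_sum_eq hA n).mono fun ω h => by omega)
  rw [← Measure.restrict_eq_self_of_ae_mem hae,
    integral_iUnion_fintype hm (pairwise_disjoint_stepEvent X n) fun i => hint.integrableOn,
    Measure.restrict_eq_self_of_ae_mem hae]
  refine Finset.sum_congr rfl fun i _ => ?_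
  refine Eq.trans ?_
    (hX.setIntegral_stepEvent n i fun c => g (c (Fin.last n) + Pi.single i 1) * f c)
  refine setIntegral_congr_fun (hm i) fun ω hω => ?_
  have : X (n + 1) ω = X n ω + Pi.single i 1 := hω
  simp only [this, history, Fin.val_last]

/-- The filtration generated by the process. -/
def historyFiltration (X : ℕ → Ω → Fin A → ℕ) (hX : ∀ n, Measurable (X n)) :
    Filtration ℕ (inferInstance : MeasurableSpace Ω) where
  seq n := MeasurableSpace.comap (history X n) inferInstance
  mono' := by
    intro m n hmn
    have : history X m = (fun c k => c (Fin.castLE (by omega) k)) ∘ history X n := rfl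
    change MeasurableSpace.comap (history X m) _ ≤ _
    rw [this, ← MeasurableSpace.comap_comp]
    exact MeasurableSpace.comap_mono (measurable_of_countable _).comap_le
  le' n := (measurable_pi_lambda _ fun k => hX k : Measurable (history X n)).comap_le

/-- With total `N = n + A`, the expected next share is `∑ i, (x i / N) (x j + δ i j) / (N + 1) = x j
(N + 1) / (N (N + 1)) = x j / N`. -/
theorem martingale_share
    (hX : IsPolyaUrn P (fun (_ : Fin A) (k : ℕ) => (k : ℝ)) (fun _ => 1) X) (j : Fin A) :
    Martingale (share X j) (historyFiltration X hX.measurable) P := by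
  have hA : 0 < A := j.pos
  refine martingale_of_setIntegral_eq_succ (fun n => ?_)
    (fun n => integrable_share hX.measurable j n) fun n s hs => ?_
  · refine Measurable.stronglyMeasurable ?_
    have : share X j n = (fun c : Fin (n + 1) → Fin A → ℕ =>
      (c (Fin.last n) j : ℝ) / ∑ i, (c (Fin.last n) i : ℝ)) ∘ history X n := rfl
    rw [this]
    exact (measurable_of_countable _).comp (comap_measurable _)
  · obtain ⟨T, -, rfl⟩ := hs
    have hT : MeasurableSet (history X n ⁻¹' T) :=
      hX.measurable_history n T.to_countable.measurableSet
    classical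
    set f : (Fin (n + 1) → Fin A → ℕ) → ℝ := T.indicator 1 with hf
    set g : (Fin A → ℕ) → ℝ := fun c => (c j : ℝ) / ∑ i, (c i : ℝ) with hg
    have hfI : ∀ c, |f c| ≤ 1 := fun c => by
      by_cases h : c ∈ T <;> simp [hf, h]
    have hgI : ∀ c, |g c| ≤ 1 := fun c => by
      rw [abs_of_nonneg (by positivity)]
      exact share_le_one (fun _ (_ : Ω) => c) j 0 (Classical.choice P.nonempty_of_neZero)
    have key : ∀ m, ∫ ω in history X n ⁻¹' T, share X j m ω ∂P =
        ∫ ω, g (X m ω) * f (history X n ω) ∂P := fun m => by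
      rw [← integral_indicator hT]
      refine integral_congr_ae (Eventually.of_forall fun ω => ?_)
      by_cases h : history X n ω ∈ T <;> simp [hf, hg, h, share]
    rw [key, key, hX.integral_mul_history_succ hA n g f hgI hfI, ← integral_finsetSum]
    · refine integral_congr_ae ?_
      filter_upwards [hX.ae_one_le_and_sum_eq hA n] with ω hω
      have hs : ∑ i, (X n ω i : ℝ) = n + A := by exact_mod_cast hω.2
      have hpos : (0 : ℝ) < n + A := by positivity
      have h1 : ∀ i, g (X n ω + Pi.single i 1) =
          (X n ω j + if j = i then 1 else 0) / (n + A + 1) := fun i => by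
        simp only [hg, Pi.add_apply, Nat.cast_add, Finset.sum_add_distrib, hs, Pi.single_apply]
        simp
      simp_rw [h1]
      simp only [hg, hs, share]
      simp_rw [← mul_assoc]
      rw [← Finset.sum_mul]
      congr 1
      have h2 : ∀ i, (X n ω i : ℝ) / (n + A) * ((X n ω j + if j = i then 1 else 0) / (n + A + 1)) =
          ((X n ω i : ℝ) * X n ω j + if j = i then (X n ω i : ℝ) else 0) /
            ((n + A) * (n + A + 1)) := fun i => by
        split_ifs <;> field_simp
        ring
      simp_rw [h2]
      rw [← Finset.sum_div, Finset.sum_add_distrib, ← Finset.sum_mul, hs]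
      simp only [Finset.sum_ite_eq, Finset.mem_univ, if_true]
      field_simp
    · intro i _
      refine integrable_of_abs_le_one ((measurable_share hX.measurable i n).mul
        (((measurable_of_countable g).fun_comp ((hX.measurable n).add_const _)).mul
        ((measurable_of_countable f).fun_comp (hX.measurable_history n)))) fun ω => ?_
      rw [abs_mul, abs_mul, abs_of_nonneg (share_nonneg X i n ω)]
      exact mul_le_one₀ (share_le_one X i n ω) (by positivity)
        (mul_le_one₀ (hgI _) (abs_nonneg _) (hfI _))

theorem ae_tendsto_share
    (hX : IsPolyaUrn P (fun (_ : Fin A) (k : ℕ) => (k : ℝ)) (fun _ => 1) X) :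
    ∀ᵐ ω ∂P, ∀ i, Tendsto (fun n => share X i n ω) atTop (𝓝 (limitShare X i ω)) := by
  rw [ae_all_iff]
  intro i
  have h : ∀ n, eLpNorm (share X i n) 1 P ≤ (1 : NNReal) := fun n => by
    refine (eLpNorm_le_of_ae_bound (C := 1) (Eventually.of_forall fun ω => ?_)).trans ?_
    · rw [Real.norm_of_nonneg (share_nonneg X i n ω)]; exact share_le_one X i n ω
    · simp
  filter_upwards [(hX.martingale_share i).submartingale.exists_ae_tendsto_of_bdd h] with ω hω
  exact tendsto_nhds_limUnder hω

theorem measurable_limitShare (hX : ∀ n, Measurable (X n)) (i : Fin A) :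
    Measurable (limitShare X i) :=
  (StronglyMeasurable.limUnder fun n => (measurable_share hX i n).stronglyMeasurable).measurable

omit [MeasurableSpace Ω] in
theorem limitShare_mem_Icc {ω : Ω} {i : Fin A}
    (h : Tendsto (fun n => share X i n ω) atTop (𝓝 (limitShare X i ω))) :
    limitShare X i ω ∈ Set.Icc (0 : ℝ) 1 :=
  isClosed_Icc.mem_of_tendsto h
    (Eventually.of_forall fun n => ⟨share_nonneg X i n ω, share_le_one X i n ω⟩)

end Linear

end IsPolyaUrn

/-! ### Fatou for events and asymptotics of the counting formula -/

theorem measureReal_eq_one_of_ae_mem {Ω : Type*} [MeasurableSpace Ω] {P : Measure Ω}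
    [IsProbabilityMeasure P] {s : Set Ω} (h : ∀ᵐ ω ∂P, ω ∈ s) : P.real s = 1 := by
  rw [measureReal_congr (show s =ᵐ[P] Set.univ from eventuallyEq_univ.2 h), probReal_univ]

/-- Fatou's lemma for events. -/
theorem measureReal_le_of_eventually_mem {Ω : Type*} [MeasurableSpace Ω] {P : Measure Ω}
    [IsFiniteMeasure P] {B : Set Ω} {E : ℕ → Set Ω} {g : ℝ}
    (h : ∀ᵐ ω ∂P, ω ∈ B → ∀ᶠ n in atTop, ω ∈ E n)
    (hE : Tendsto (fun n => P.real (E n)) atTop (𝓝 g)) : P.real B ≤ g := by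
  set L : ℕ → Set Ω := fun n => ⋂ k ≥ n, E k with hL
  have hmono : Monotone L := fun a b hab =>
    Set.biInter_subset_biInter_left fun k hk => le_trans hab hk
  have h1 : Tendsto (fun n => P.real (L n)) atTop (𝓝 (P.real (⋃ n, L n))) :=
    (ENNReal.tendsto_toReal (measure_ne_top _ _)).comp (tendsto_measure_iUnion_atTop hmono)
  have h2 : P.real B ≤ P.real (⋃ n, L n) := by
    refine ENNReal.toReal_mono (measure_ne_top _ _) (measure_mono_ae ?_)
    filter_upwards [h] with ω hω hB
    obtain ⟨n, hn⟩ := eventually_atTop.1 (hω hB)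
    exact Set.mem_iUnion.2 ⟨n, Set.mem_iInter₂.2 hn⟩
  exact h2.trans (le_of_tendsto_of_tendsto' h1 hE fun n =>
    measureReal_mono (Set.biInter_subset_of_mem (le_refl n)))

/-- For integers `X ≥ 1`, the condition `t (n + a) ≤ X` reads `1 + k ≤ X` with `k` this truncated
difference. -/
theorem tendsto_natCeil_mul_add_sub_one_div {t : ℝ} (ht : 0 ≤ t) (a : ℝ) (ha : 0 ≤ a) :
    Tendsto (fun n : ℕ => ((⌈t * (n + a)⌉₊ - 1 : ℕ) : ℝ) / n) atTop (𝓝 t) := by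
  have hn : Tendsto (fun n : ℕ => (n : ℝ)) atTop atTop := tendsto_natCast_atTop_atTop
  have h1 : Tendsto (fun n : ℕ => t + (t * a - 1) / n) atTop (𝓝 t) := by
    simpa using tendsto_const_nhds.add (tendsto_const_nhds.div_atTop hn)
  have h2 : Tendsto (fun n : ℕ => t + (t * a) / n) atTop (𝓝 t) := by
    simpa using tendsto_const_nhds.add (tendsto_const_nhds.div_atTop hn)
  refine tendsto_of_tendsto_of_tendsto_of_le_of_le' h1 h2 ?_ ?_
  · filter_upwards [eventually_gt_atTop 0] with n hn
    have hn' : (0 : ℝ) < n := by exact_mod_cast hn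
    rw [le_div_iff₀ hn', add_mul, div_mul_cancel₀ _ hn'.ne']
    have h3 := Nat.le_ceil (t * (n + a))
    have h4 : (⌈t * (n + a)⌉₊ : ℝ) ≤ ((⌈t * (n + a)⌉₊ - 1 : ℕ) : ℝ) + 1 := by
      exact_mod_cast le_tsub_add
    linarith
  · filter_upwards [eventually_gt_atTop 0] with n hn
    have hn' : (0 : ℝ) < n := by exact_mod_cast hn
    have hnn : 0 ≤ t * (n + a) := by positivity
    rw [div_le_iff₀ hn', add_mul, div_mul_cancel₀ _ hn'.ne']
    rcases Nat.eq_zero_or_pos ⌈t * (n + a)⌉₊ with h | h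
    · rw [h]; simp; linarith
    · have h3 := Nat.ceil_lt_add_one hnn
      rw [Nat.cast_sub h]
      push_cast
      linarith

theorem tendsto_ascFactorial_div (m : ℕ) {K : ℕ → ℕ} {s : ℝ} (hs : s < 1)
    (hK : Tendsto (fun n => (K n : ℝ) / n) atTop (𝓝 s)) :
    Tendsto (fun n => ((n - K n + 1).ascFactorial m : ℝ) / (n + 1).ascFactorial m) atTop
      (𝓝 ((1 - s) ^ m)) := by
  have hle : ∀ᶠ n in atTop, K n ≤ n := by
    filter_upwards [hK.eventually (gt_mem_nhds hs), eventually_gt_atTop 0] with n h1 h2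
    have hn' : (0 : ℝ) < n := by exact_mod_cast h2
    rw [div_lt_one hn'] at h1
    exact_mod_cast h1.le
  have hn : Tendsto (fun n : ℕ => (n : ℝ)) atTop atTop := tendsto_natCast_atTop_atTop
  have hfac : ∀ j : ℕ, Tendsto (fun n : ℕ => ((n : ℝ) - K n + 1 + j) / (n + 1 + j)) atTop
      (𝓝 (1 - s)) := fun j => by
    have h0 : Tendsto (fun n : ℕ => (1 + j : ℝ) / n) atTop (𝓝 0) := tendsto_const_nhds.div_atTop hn
    have h1 : Tendsto (fun n : ℕ => (1 - (K n : ℝ) / n + (1 + j) / n) / (1 + (1 + j) / n)) atTop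
        (𝓝 ((1 - s + 0) / (1 + 0))) :=
      ((tendsto_const_nhds.sub hK).add h0).div (tendsto_const_nhds.add h0) (by norm_num)
    simp only [add_zero, div_one] at h1
    refine h1.congr' ?_
    filter_upwards [eventually_gt_atTop 0] with n h2
    have hn' : (0 : ℝ) < n := by exact_mod_cast h2
    field_simp
    ring_nf
  have h := tendsto_finsetProd (Finset.range m) fun j _ => hfac j
  rw [Finset.prod_const, Finset.card_range] at h
  refine h.congr' ?_
  filter_upwards [hle] with n hn
  rw [Nat.ascFactorial_eq_prod_range, Nat.ascFactorial_eq_prod_range, Finset.prod_div_distrib]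
  push_cast [Nat.cast_sub hn]
  rfl

/-! ### Uniform law of the configuration and joint tail of the limit shares -/

namespace IsPolyaUrn

variable {Ω : Type*} [MeasurableSpace Ω] {P : Measure Ω} [IsProbabilityMeasure P]

/-- The value does not depend on `c`. Inductively, `c` is reached from `c - e_i` with probability
`(c i - 1) / (n + m + 1)`, and these weights sum to `(n + 1) / (n + m + 1)` whatever `c` is. -/
theorem measureReal_eq_config {m : ℕ} {X : ℕ → Ω → Fin (m + 1) → ℕ}
    (hX : IsPolyaUrn P (fun (_ : Fin (m + 1)) (k : ℕ) => (k : ℝ)) (fun _ => 1) X) (n : ℕ) :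
    ∀ c : Fin (m + 1) → ℕ, (∀ i, 1 ≤ c i) → ∑ i, c i = n + (m + 1) →
      P.real {ω | X n ω = c} = (m.factorial : ℝ) / (n + 1).ascFactorial m := by
  induction n with
  | zero =>
    intro c hc hs
    have hc1 : ∀ i ∈ Finset.univ, (1 : ℕ) = c i :=
      (Finset.sum_eq_sum_iff_of_le fun i _ => hc i).1 (by simp [hs])
    have : c = fun _ => 1 := funext fun i => (hc1 i (Finset.mem_univ i)).symm
    have h1 : P.real {ω | X 0 ω = c} = 1 :=
      measureReal_eq_one_of_ae_mem (this ▸ hX.initial)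
    rw [h1, Nat.zero_add, Nat.one_ascFactorial, div_self]
    exact_mod_cast m.factorial_ne_zero
  | succ n ih =>
    intro c hc hs
    classical
    set g : (Fin (m + 1) → ℕ) → ℝ := fun d => if d = c then 1 else 0 with hg
    have hgI : ∀ d, |g d| ≤ 1 := fun d => by by_cases h : d = c <;> simp [hg, h]
    have hind : ∀ (k : ℕ) (d : Fin (m + 1) → ℕ),
        ∫ ω, (if X k ω = d then (1 : ℝ) else 0) ∂P = P.real {ω | X k ω = d} := fun k d => by
      have hms : MeasurableSet {ω | X k ω = d} := hX.measurable k (measurableSet_singleton d)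
      rw [← integral_indicator_one hms]
      refine integral_congr_ae (Eventually.of_forall fun ω => ?_)
      by_cases h : X k ω = d <;> simp [h]
    have h := hX.integral_mul_history_succ m.succ_pos n g (fun _ => 1) hgI (by simp)
    simp only [mul_one] at h
    rw [hind] at h
    rw [h]
    have hN : (0 : ℝ) < n + (m + 1) := by positivity
    have hterm : ∀ i, ∫ ω, share X i n ω * g (X n ω + Pi.single i 1) ∂P =
        ((c i : ℝ) - 1) / (n + (m + 1)) * ((m.factorial : ℝ) / (n + 1).ascFactorial m) := by
      intro i
      set d : Fin (m + 1) → ℕ := c - Pi.single i 1 with hd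
      have hle : Pi.single i 1 ≤ c := fun j => by
        rcases eq_or_ne j i with rfl | hj
        · simpa using hc j
        · simp [hj]
      have hdc : d + Pi.single i 1 = c := tsub_add_cancel_of_le hle
      have hdi : (d i : ℝ) = c i - 1 := by
        rw [← hdc]; simp
      have hsum : ∑ j, d j = n + (m + 1) := by
        have h1 : ∑ j, (d j + (Pi.single i 1 : Fin (m + 1) → ℕ) j) = n + 1 + (m + 1) := by
          rw [← hs]; exact Finset.sum_congr rfl fun j _ => congrFun hdc j
        rw [Finset.sum_add_distrib, Finset.sum_pi_single'] at h1
        simp only [Finset.mem_univ, if_true] at h1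
        omega
      have hpt : ∀ ω, share X i n ω * g (X n ω + Pi.single i 1) =
          ((c i : ℝ) - 1) / (n + (m + 1)) * (if X n ω = d then (1 : ℝ) else 0) := fun ω => by
        by_cases hω : X n ω = d
        · have hs' : ∑ j, (d j : ℝ) = n + (m + 1) := by exact_mod_cast hsum
          simp [share, hω, hdc, hg, hdi, hs']
        · have : X n ω + Pi.single i 1 ≠ c := fun h => hω (add_right_cancel (h.trans hdc.symm))
          simp [hg, this, hω]
      simp_rw [hpt]
      rw [integral_const_mul, hind]
      -- If `c i = 1`, the predecessor has a zero entry and the induction hypothesis does not apply,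
      -- but the weight `c i - 1` vanishes.
      rcases (hc i).eq_or_lt with h1 | h1
      · simp [← h1]
      · rw [ih d (fun j => ?_) hsum]
        rcases eq_or_ne j i with rfl | hj
        · simp [hd]; omega
        · simpa [hd, hj] using hc j
    simp_rw [hterm]
    rw [← Finset.sum_mul, ← Finset.sum_div, Finset.sum_sub_distrib]
    have hs' : ∑ j, (c j : ℝ) = n + 1 + (m + 1) := by exact_mod_cast hs
    rw [hs']
    have hasc : ((n + 1 : ℕ) : ℝ) * (n + 1 + 1).ascFactorial m =
        ((n + 1 + m : ℕ) : ℝ) * (n + 1).ascFactorial m := by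
      exact_mod_cast Nat.succ_ascFactorial (n + 1) m
    have hp1 : (0 : ℝ) < (n + 1).ascFactorial m := by exact_mod_cast Nat.ascFactorial_pos n m
    have hp2 : (0 : ℝ) < (n + 1 + 1).ascFactorial m := by
      exact_mod_cast Nat.ascFactorial_pos (n + 1) m
    push_cast at hasc
    simp only [Finset.sum_const, Finset.card_univ, Fintype.card_fin, nsmul_eq_mul, mul_one]
    push_cast
    field_simp
    linear_combination hasc

theorem measureReal_forall_le_eq_card {m : ℕ} {X : ℕ → Ω → Fin (m + 1) → ℕ}
    (hX : IsPolyaUrn P (fun (_ : Fin (m + 1)) (k : ℕ) => (k : ℝ)) (fun _ => 1) X) (n : ℕ)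
    (k : Fin (m + 1) → ℕ) (hk : ∑ i, k i ≤ n) :
    P.real {ω | ∀ i, 1 + k i ≤ X n ω i} =
      (Finset.piAntidiag (Finset.univ : Finset (Fin (m + 1))) (n - ∑ i, k i)).card *
        ((m.factorial : ℝ) / (n + 1).ascFactorial m) := by
  set D := Finset.piAntidiag (Finset.univ : Finset (Fin (m + 1))) (n - ∑ i, k i)
  have h1 : P.real {ω | ∀ i, 1 + k i ≤ X n ω i} =
      P.real (⋃ d ∈ D, {ω | X n ω = fun i => d i + (1 + k i)}) := by
    refine measureReal_congr ?_
    filter_upwards [hX.ae_one_le_and_sum_eq m.succ_pos n] with ω hω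
    refine propext ⟨fun (h : ∀ i, 1 + k i ≤ X n ω i) => ?_, fun h => ?_⟩
    · refine Set.mem_iUnion₂.2 ⟨fun i => X n ω i - (1 + k i), ?_, ?_⟩
      · rw [Finset.mem_piAntidiag]
        refine ⟨?_, by simp⟩
        have h2 : ∑ i, (X n ω i - (1 + k i) + (1 + k i)) = n + (m + 1) := by
          rw [← hω.2]; exact Finset.sum_congr rfl fun i _ => Nat.sub_add_cancel (h i)
        rw [Finset.sum_add_distrib, Finset.sum_add_distrib (f := fun _ => 1)] at h2
        simp only [Finset.sum_const, Finset.card_univ, Fintype.card_fin, smul_eq_mul, mul_one] at h2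
        omega
      · exact funext fun i => (Nat.sub_add_cancel (h i)).symm
    · obtain ⟨d, -, hd⟩ := Set.mem_iUnion₂.1 h
      intro i
      have hd' : X n ω = fun i => d i + (1 + k i) := hd
      rw [hd']
      exact Nat.le_add_left _ _
  rw [h1, measureReal_biUnion_finset]
  · rw [Finset.sum_congr rfl fun d hd => hX.measureReal_eq_config n _ (fun i => ?_) ?_]
    · rw [Finset.sum_const, nsmul_eq_mul]
    · omega
    · have hd' := (Finset.mem_piAntidiag.1 hd).1
      rw [Finset.sum_add_distrib, Finset.sum_add_distrib (f := fun _ => 1), hd']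
      simp only [Finset.sum_const, Finset.card_univ, Fintype.card_fin, smul_eq_mul, mul_one]
      omega
  · intro d _ e _ hde
    refine Set.disjoint_left.2 fun ω h h' => hde (funext fun i => ?_)
    have := congrFun (Eq.trans (Eq.symm h) h') i
    simpa using this
  · exact fun d _ => hX.measurable n (measurableSet_singleton _)

/-- No explicit count is needed: the antidiagonal also counts all configurations at time `n - ∑ i, k
i`, where the total probability is `1`, so its cardinality can be eliminated. -/
theorem measureReal_forall_le_config {m : ℕ} {X : ℕ → Ω → Fin (m + 1) → ℕ}
    (hX : IsPolyaUrn P (fun (_ : Fin (m + 1)) (k : ℕ) => (k : ℝ)) (fun _ => 1) X) (n : ℕ)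
    (k : Fin (m + 1) → ℕ) (hk : ∑ i, k i ≤ n) :
    P.real {ω | ∀ i, 1 + k i ≤ X n ω i} =
      ((n - ∑ i, k i + 1).ascFactorial m : ℝ) / (n + 1).ascFactorial m := by
  have h0 := hX.measureReal_forall_le_eq_card (n - ∑ i, k i) 0 (by simp)
  have h1 : P.real {ω | ∀ i, 1 + (0 : Fin (m + 1) → ℕ) i ≤ X (n - ∑ i, k i) ω i} = 1 :=
    measureReal_eq_one_of_ae_mem
      ((hX.ae_one_le_and_sum_eq m.succ_pos (n - ∑ i, k i)).mono fun ω hω => hω.1)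
  rw [h1] at h0
  simp only [Pi.zero_apply, Finset.sum_const_zero, Nat.sub_zero] at h0
  rw [hX.measureReal_forall_le_eq_card n k hk]
  have hp : (0 : ℝ) < (n - ∑ i, k i + 1).ascFactorial m := by
    exact_mod_cast Nat.ascFactorial_pos _ m
  rw [← mul_div_assoc] at h0 ⊢
  rw [eq_comm, div_eq_one_iff_eq hp.ne'] at h0
  rw [h0]

theorem tendsto_measureReal_forall_le_share {m : ℕ} {X : ℕ → Ω → Fin (m + 1) → ℕ}
    (hX : IsPolyaUrn P (fun (_ : Fin (m + 1)) (k : ℕ) => (k : ℝ)) (fun _ => 1) X)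
    (t : Fin (m + 1) → ℝ) (ht : ∀ i, 0 ≤ t i) (hs : ∑ i, t i < 1) :
    Tendsto (fun n => P.real {ω | ∀ i, t i ≤ share X i n ω}) atTop (𝓝 ((1 - ∑ i, t i) ^ m)) := by
  set k : ℕ → Fin (m + 1) → ℕ := fun n i => ⌈t i * (n + (m + 1 : ℕ))⌉₊ - 1 with hk
  have hK : Tendsto (fun n => ((∑ i, k n i : ℕ) : ℝ) / n) atTop (𝓝 (∑ i, t i)) := by
    have := tendsto_finsetSum Finset.univ fun i _ =>
      tendsto_natCeil_mul_add_sub_one_div (ht i) ((m + 1 : ℕ) : ℝ) (Nat.cast_nonneg _)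
    refine this.congr fun n => ?_
    rw [Nat.cast_sum, Finset.sum_div]
  refine (tendsto_ascFactorial_div m hs hK).congr' ?_
  filter_upwards [hK.eventually (gt_mem_nhds hs), eventually_gt_atTop 0] with n h1 h2
  have hn' : (0 : ℝ) < n := by exact_mod_cast h2
  rw [div_lt_one hn'] at h1
  rw [← hX.measureReal_forall_le_config n (k n) (by exact_mod_cast h1.le)]
  refine measureReal_congr ?_
  filter_upwards [hX.ae_one_le_and_sum_eq m.succ_pos n] with ω hω
  refine propext (forall_congr' fun i => ?_)
  have hs : ∑ i, (X n ω i : ℝ) = n + (m + 1 : ℕ) := by exact_mod_cast hω.2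
  have hpos : (0 : ℝ) < n + (m + 1 : ℕ) := by positivity
  rw [share, hs, le_div_iff₀ hpos, ← Nat.ceil_le]
  have := hω.1 i
  simp only [hk]
  omega

/-- Fatou turns the limit for `share` into the upper bound. For the lower bound, Fatou is applied to
the complement with thresholds raised by `δ`, which also yields the strict inequality; then `δ → 0`.
Agents outside `S` get threshold `0`, which is no constraint. -/
theorem measureReal_forall_lt_limitShare {A : ℕ} {X : ℕ → Ω → Fin A → ℕ}
    (hX : IsPolyaUrn P (fun (_ : Fin A) (k : ℕ) => (k : ℝ)) (fun _ => 1) X) (hA : 0 < A)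
    (S : Finset (Fin A)) (t : Fin A → ℝ) (ht : ∀ i ∈ S, 0 ≤ t i) (hs : ∑ i ∈ S, t i < 1) :
    P.real {ω | ∀ i ∈ S, t i < limitShare X i ω} = (1 - ∑ i ∈ S, t i) ^ (A - 1) := by
  obtain ⟨m, rfl⟩ : ∃ m, A = m + 1 := ⟨A - 1, by omega⟩
  classical
  rw [Nat.add_sub_cancel]
  have hsum : ∀ u : Fin (m + 1) → ℝ, ∑ i, (if i ∈ S then u i else 0) = ∑ i ∈ S, u i := fun u => by
    simp
  refine le_antisymm ?_ ?_
  · have hlim := hX.tendsto_measureReal_forall_le_share (fun i => if i ∈ S then t i else 0)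
      (fun i => by split_ifs with h; exacts [ht i h, le_rfl]) (by rw [hsum]; exact hs)
    rw [hsum] at hlim
    refine measureReal_le_of_eventually_mem ?_ hlim
    filter_upwards [hX.ae_tendsto_share] with ω hω hB
    refine eventually_all.2 fun i => ?_
    by_cases hi : i ∈ S
    · filter_upwards [(hω i).eventually (lt_mem_nhds (hB i hi))] with n hn
      simpa [hi] using hn.le
    · exact Eventually.of_forall fun n => by simpa [hi] using share_nonneg X i n ω
  · have hcont : Tendsto (fun δ : ℝ => (1 - ∑ i ∈ S, (t i + δ)) ^ m) (𝓝[>] 0)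
        (𝓝 ((1 - ∑ i ∈ S, t i) ^ m)) := by
      have : Continuous fun δ : ℝ => (1 - ∑ i ∈ S, (t i + δ)) ^ m := by fun_prop
      simpa using (this.tendsto 0).mono_left nhdsWithin_le_nhds
    have hlt : ∀ᶠ δ : ℝ in 𝓝[>] 0, ∑ i ∈ S, (t i + δ) < 1 := by
      have : Continuous fun δ : ℝ => ∑ i ∈ S, (t i + δ) := by fun_prop
      refine ((this.tendsto 0).mono_left nhdsWithin_le_nhds).eventually (gt_mem_nhds ?_)
      simpa using hs
    refine le_of_tendsto hcont ?_
    filter_upwards [hlt, self_mem_nhdsWithin] with δ hδ hδ0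
    have hδ0' : 0 < δ := hδ0
    set u : Fin (m + 1) → ℝ := fun i => if i ∈ S then t i + δ else 0 with hu
    have hus : ∑ i, u i = ∑ i ∈ S, (t i + δ) := hsum fun i => t i + δ
    have hlim := hX.tendsto_measureReal_forall_le_share u
      (fun i => by
        simp only [hu]; split_ifs with h
        exacts [add_nonneg (ht i h) hδ0'.le, le_rfl]) (by rw [hus]; exact hδ)
    rw [hus] at hlim
    have hmE : ∀ n, MeasurableSet {ω | ∀ i, u i ≤ share X i n ω} := fun n => by
      simp only [Set.ofPred_forall]
      exact MeasurableSet.iInter fun i =>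
        measurableSet_le measurable_const (measurable_share hX.measurable i n)
    have hmL : MeasurableSet {ω | ∀ i, u i ≤ limitShare X i ω} := by
      simp only [Set.ofPred_forall]
      exact MeasurableSet.iInter fun i =>
        measurableSet_le measurable_const (measurable_limitShare hX.measurable i)
    have hfat : P.real {ω | ∀ i, u i ≤ limitShare X i ω}ᶜ ≤ 1 - (1 - ∑ i ∈ S, (t i + δ)) ^ m := by
      refine measureReal_le_of_eventually_mem (E := fun n => {ω | ∀ i, u i ≤ share X i n ω}ᶜ) ?_ ?_
      · filter_upwards [hX.ae_tendsto_share] with ω hω hB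
        simp only [Set.mem_compl_iff, Set.mem_ofPred_eq, not_forall, not_le] at hB ⊢
        obtain ⟨i, hi⟩ := hB
        exact ((hω i).eventually (gt_mem_nhds hi)).mono fun n hn => ⟨i, hn⟩
      · simp_rw [probReal_compl_eq_one_sub (hmE _)]
        exact tendsto_const_nhds.sub hlim
    rw [probReal_compl_eq_one_sub hmL] at hfat
    refine le_trans (by linarith : _ ≤ P.real {ω | ∀ i, u i ≤ limitShare X i ω}) ?_
    refine measureReal_mono fun ω hω i hi => ?_
    have := hω i
    simp only [hu, hi, if_true] at this
    linarith

end IsPolyaUrn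

/-! ### Exponential limit, inclusion-exclusion, convergence to a constant -/

theorem tendsto_one_sub_div_pow_pred (s : ℝ) :
    Tendsto (fun n : ℕ => (1 - s / n) ^ (n - 1)) atTop (𝓝 (Real.exp (-s))) := by
  have h0 : Tendsto (fun n : ℕ => 1 - s / (n : ℝ)) atTop (𝓝 1) := by
    simpa using tendsto_const_nhds.sub
      ((tendsto_const_nhds (x := s)).div_atTop tendsto_natCast_atTop_atTop)
  have h1 : Tendsto (fun n : ℕ => (1 - s / (n : ℝ)) ^ n / (1 - s / n)) atTop
      (𝓝 (Real.exp (-s) / 1)) := by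
    refine Tendsto.div ?_ h0 one_ne_zero
    refine (Real.tendsto_one_add_div_pow_exp (-s)).congr fun n => ?_
    rw [neg_div, sub_eq_add_neg]
  rw [div_one] at h1
  refine h1.congr' ?_
  filter_upwards [h0.eventually (lt_mem_nhds one_pos), eventually_gt_atTop 0] with n hn hn0
  obtain ⟨k, rfl⟩ : ∃ k, n = k + 1 := ⟨n - 1, by omega⟩
  rw [Nat.add_sub_cancel, pow_succ, mul_div_assoc, div_self hn.ne', mul_one]

/-- The inclusion-exclusion formula for the probability that none of finitely many events occurs. -/
theorem measureReal_forall_notMem_eq_sum {Ω ι : Type*} [MeasurableSpace Ω] {P : Measure Ω}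
    [IsProbabilityMeasure P] [Fintype ι] (B : ι → Set Ω) (hB : ∀ i, MeasurableSet (B i)) :
    P.real {ω | ∀ i, ω ∉ B i} =
      ∑ S ∈ (Finset.univ : Finset ι).powerset, (-1) ^ S.card * P.real {ω | ∀ i ∈ S, ω ∈ B i} := by
  classical
  have hms : ∀ S : Finset ι, MeasurableSet {ω | ∀ i ∈ S, ω ∈ B i} := fun S => by
    have : {ω | ∀ i ∈ S, ω ∈ B i} = ⋂ i ∈ S, B i := by ext; simp
    rw [this]
    exact S.measurableSet_biInter fun i _ => hB i
  have hmn : MeasurableSet {ω | ∀ i, ω ∉ B i} := by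
    have : {ω | ∀ i, ω ∉ B i} = ⋂ i, (B i)ᶜ := by ext; simp
    rw [this]
    exact MeasurableSet.iInter fun i => (hB i).compl
  have hprod : ∀ (S : Finset ι) (ω : Ω), ∏ i ∈ S, (B i).indicator (1 : Ω → ℝ) ω =
      {ω | ∀ i ∈ S, ω ∈ B i}.indicator 1 ω := fun S ω => by
    by_cases h : ∀ i ∈ S, ω ∈ B i
    · rw [Set.indicator_of_mem (by exact h)]
      exact Finset.prod_eq_one fun i hi => by simp [h i hi]
    · rw [Set.indicator_of_notMem (by exact h)]
      push Not at h
      obtain ⟨i, hi, hω⟩ := h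
      exact Finset.prod_eq_zero hi (by simp [hω])
  have hpt : ∀ ω, {ω | ∀ i, ω ∉ B i}.indicator (1 : Ω → ℝ) ω =
      ∑ S ∈ (Finset.univ : Finset ι).powerset,
        (-1) ^ S.card * {ω | ∀ i ∈ S, ω ∈ B i}.indicator (1 : Ω → ℝ) ω := fun ω => by
    have h1 : {ω | ∀ i, ω ∉ B i}.indicator (1 : Ω → ℝ) ω =
        ∏ i, (1 + -(B i).indicator (1 : Ω → ℝ) ω) := by
      by_cases h : ∀ i, ω ∉ B i
      · rw [Set.indicator_of_mem (by exact h)]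
        exact (Finset.prod_eq_one fun i _ => by simp [h i]).symm
      · rw [Set.indicator_of_notMem (by exact h)]
        push Not at h
        obtain ⟨i, hω⟩ := h
        exact (Finset.prod_eq_zero (Finset.mem_univ i) (by simp [hω])).symm
    rw [h1, Finset.prod_one_add]
    refine Finset.sum_congr rfl fun S _ => ?_
    rw [Finset.prod_neg, hprod]
  rw [← integral_indicator_one hmn, integral_congr_ae (Eventually.of_forall hpt),
    integral_finsetSum]
  · refine Finset.sum_congr rfl fun S _ => ?_
    rw [integral_const_mul, integral_indicator_one (hms S)]
  · exact fun S _ => ((integrable_const (1 : ℝ)).indicator (hms S)).const_mul _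

/-- Convergence in probability to a constant implies convergence in distribution, for random
variables defined on different probability spaces. -/
theorem tendstoInDistribution_of_tendsto_measureReal {Ω : ℕ → Type*} [∀ A, MeasurableSpace (Ω A)]
    (P : ∀ A, Measure (Ω A)) [∀ A, IsProbabilityMeasure (P A)] (Y : ∀ A, Ω A → ℝ) (c : ℝ)
    (hY : ∀ A, Measurable (Y A))
    (h : ∀ ε > 0, Tendsto (fun A => (P A).real {ω | ε ≤ |Y A ω - c|}) atTop (𝓝 0)) :
    TendstoInDistribution Y atTop (fun _ : Unit => c) P (Measure.dirac ()) where
  forall_aemeasurable A := (hY A).aemeasurable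
  tendsto := by
    -- Portmanteau: only open sets containing `c` have positive mass in the limit, and they contain
    -- a ball around `c`.
    refine tendsto_of_forall_isOpen_le_liminf' fun G hG => ?_
    simp only [ProbabilityMeasure.coe_mk]
    rw [Measure.map_dirac' measurable_const]
    by_cases hc : c ∈ G
    · obtain ⟨ε, hε, hball⟩ := Metric.isOpen_iff.1 hG c hc
      have h1 : Tendsto (fun A => ENNReal.ofReal (1 - (P A).real {ω | ε ≤ |Y A ω - c|})) atTop
          (𝓝 1) := by
        simpa using ENNReal.tendsto_ofReal ((tendsto_const_nhds (x := (1 : ℝ))).sub (h ε hε))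
      refine prob_le_one.trans ?_
      rw [← h1.liminf_eq]
      refine liminf_le_liminf (Eventually.of_forall fun A => ?_)
      have hm : MeasurableSet {ω | ε ≤ |Y A ω - c|} :=
        measurableSet_le measurable_const ((hY A).sub_const c).abs
      rw [← probReal_compl_eq_one_sub hm, ofReal_measureReal,
        Measure.map_apply (hY A) hG.measurableSet]
      refine measure_mono fun ω hω => hball ?_
      rw [Metric.mem_ball, Real.dist_eq]
      simpa using hω
    · rw [Measure.dirac_apply' _ hG.measurableSet]
      simp [hc]

/-! ### Second moment of exceedance counts and joint convergence of finitely many shares -/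

namespace IsPolyaUrn

section Single

variable {Ω : Type*} [MeasurableSpace Ω] {P : Measure Ω} [IsProbabilityMeasure P] {A : ℕ}
  {X : ℕ → Ω → Fin A → ℕ}

/-- The number of agents whose long-time share exceeds `t`. -/
noncomputable def exceedCount {Ω : Type*} {A : ℕ} (X : ℕ → Ω → Fin A → ℕ) (t : ℝ) (ω : Ω) : ℝ :=
  ∑ i : Fin A, {ω | t < limitShare X i ω}.indicator 1 ω

theorem measurableSet_lt_limitShare (hX : ∀ n, Measurable (X n)) (t : ℝ) (i : Fin A) :
    MeasurableSet {ω | t < limitShare X i ω} :=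
  measurableSet_lt measurable_const (measurable_limitShare hX i)

/-- Variance at most mean: off-diagonal pairs contribute at most `p ^ 2` each, by nonpositive
correlation, and diagonal ones `p`. The condition `2 * t < 1` makes the tail formula available for
pairs. -/
theorem integral_sq_exceedCount_sub_le
    (hX : IsPolyaUrn P (fun (_ : Fin A) (k : ℕ) => (k : ℝ)) (fun _ => 1) X) (hA : 0 < A)
    {t : ℝ} (ht : 0 ≤ t) (ht2 : 2 * t < 1) :
    Integrable (fun ω => (exceedCount X t ω - A * (1 - t) ^ (A - 1)) ^ 2) P ∧
    ∫ ω, (exceedCount X t ω - A * (1 - t) ^ (A - 1)) ^ 2 ∂P ≤ A * (1 - t) ^ (A - 1) := by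
  classical
  set p := (1 - t) ^ (A - 1) with hp
  have hp0 : 0 ≤ p := pow_nonneg (by linarith) _
  have hm := measurableSet_lt_limitShare hX.measurable t
  set e : Fin A → Ω → ℝ := fun i => {ω | t < limitShare X i ω}.indicator 1 with he
  have hmul : ∀ i j, (fun ω => e i ω * e j ω) =
      {ω | ∀ k ∈ ({i, j} : Finset (Fin A)), t < limitShare X k ω}.indicator 1 := fun i j => by
    ext ω
    by_cases h1 : t < limitShare X i ω <;> by_cases h2 : t < limitShare X j ω <;>
      simp [he, h1, h2]
  have hm2 : ∀ i j, MeasurableSet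
      {ω | ∀ k ∈ ({i, j} : Finset (Fin A)), t < limitShare X k ω} := fun i j => by
    have : {ω | ∀ k ∈ ({i, j} : Finset (Fin A)), t < limitShare X k ω} =
      {ω | t < limitShare X i ω} ∩ {ω | t < limitShare X j ω} := by ext; simp
    rw [this]
    exact (hm i).inter (hm j)
  have hint1 : ∀ i, Integrable (e i) P := fun i => (integrable_const (1 : ℝ)).indicator (hm i)
  have hint2 : ∀ i j, Integrable (fun ω => e i ω * e j ω) P := fun i j => by
    rw [hmul]; exact (integrable_const (1 : ℝ)).indicator (hm2 i j)
  have hE1 : ∀ i, ∫ ω, e i ω ∂P = p := fun i => by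
    rw [he, integral_indicator_one (hm i)]
    have := hX.measureReal_forall_lt_limitShare hA {i} (fun _ => t) (fun _ _ => ht)
      (by simp; linarith)
    simpa using this
  have hE2 : ∀ i j, ∫ ω, e i ω * e j ω ∂P ≤ p ^ 2 + if i = j then p else 0 := fun i j => by
    rw [hmul, integral_indicator_one (hm2 i j)]
    rcases eq_or_ne i j with rfl | hij
    · rw [hX.measureReal_forall_lt_limitShare hA _ (fun _ => t) (fun _ _ => ht)
        (by simp; linarith)]
      simp [hp, sq_nonneg]
    · rw [hX.measureReal_forall_lt_limitShare hA _ (fun _ => t) (fun _ _ => ht)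
        (by rw [Finset.sum_pair hij]; linarith), Finset.sum_pair hij, if_neg hij, add_zero, hp,
        ← pow_mul, mul_comm (A - 1), pow_mul]
      -- This is `1 - 2t ≤ (1 - t)²`.
      exact pow_le_pow_left₀ (by linarith) (by nlinarith [sq_nonneg t]) _
  have hexp : ∀ ω, (exceedCount X t ω - A * p) ^ 2 =
      ∑ i, ∑ j, e i ω * e j ω - 2 * (A * p) * ∑ i, e i ω + (A * p) ^ 2 := fun ω => by
    rw [← Finset.sum_mul_sum]
    simp only [exceedCount, he]
    ring
  have hI1 : Integrable (fun ω => ∑ i, e i ω) P := integrable_finsetSum _ fun i _ => hint1 i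
  have hI2 : Integrable (fun ω => ∑ i, ∑ j, e i ω * e j ω) P :=
    integrable_finsetSum _ fun i _ => integrable_finsetSum _ fun j _ => hint2 i j
  have hS1 : ∫ ω, ∑ i, e i ω ∂P = A * p := by
    rw [integral_finsetSum _ fun i _ => hint1 i]
    simp [hE1]
  have hS2 : ∫ ω, ∑ i, ∑ j, e i ω * e j ω ∂P ≤ (A * p) ^ 2 + A * p := by
    rw [integral_finsetSum _ fun i _ => integrable_finsetSum _ fun j _ => hint2 i j]
    calc ∑ i, ∫ ω, ∑ j, e i ω * e j ω ∂P = ∑ i, ∑ j, ∫ ω, e i ω * e j ω ∂P :=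
          Finset.sum_congr rfl fun i _ => integral_finsetSum _ fun j _ => hint2 i j
      _ ≤ ∑ i : Fin A, ∑ j : Fin A, (p ^ 2 + if i = j then p else 0) :=
          Finset.sum_le_sum fun i _ => Finset.sum_le_sum fun j _ => hE2 i j
      _ = (A * p) ^ 2 + A * p := by
          simp only [Finset.sum_add_distrib, Finset.sum_const, Finset.card_univ, Fintype.card_fin,
            nsmul_eq_mul, Finset.sum_ite_eq, Finset.mem_univ, if_true]
          ring
  simp_rw [hexp]
  have hI3 : Integrable (fun ω => ∑ i, ∑ j, e i ω * e j ω - 2 * (A * p) * ∑ i, e i ω) P :=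
    hI2.sub (hI1.const_mul _)
  refine ⟨hI3.add (integrable_const _), ?_⟩
  rw [integral_add hI3 (integrable_const _),
    integral_sub hI2 (hI1.const_mul _), integral_const_mul, hS1]
  simp only [integral_const, probReal_univ, one_smul]
  nlinarith [hS2]

theorem measureReal_le_abs_exceedCount_sub
    (hX : IsPolyaUrn P (fun (_ : Fin A) (k : ℕ) => (k : ℝ)) (fun _ => 1) X) (hA : 0 < A)
    {t : ℝ} (ht : 0 ≤ t) (ht2 : 2 * t < 1) {δ : ℝ} (hδ : 0 < δ) :
    P.real {ω | δ ≤ |exceedCount X t ω - A * (1 - t) ^ (A - 1)|} ≤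
      A * (1 - t) ^ (A - 1) / δ ^ 2 := by
  obtain ⟨hint, hle⟩ := hX.integral_sq_exceedCount_sub_le hA ht ht2
  have h := mul_meas_ge_le_integral_of_nonneg (Eventually.of_forall fun ω => sq_nonneg _) hint (δ ^ 2)
  rw [le_div_iff₀ (by positivity), mul_comm]
  refine le_trans (mul_le_mul_of_nonneg_left (measureReal_mono fun ω hω => ?_) (by positivity))
    (h.trans hle)
  have hω' : δ ≤ |exceedCount X t ω - A * (1 - t) ^ (A - 1)| := hω
  change δ ^ 2 ≤ (exceedCount X t ω - A * (1 - t) ^ (A - 1)) ^ 2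
  rw [← sq_abs (exceedCount X t ω - _)]
  exact pow_le_pow_left₀ hδ.le hω' 2

end Single

section Sequence

variable {Ω : ℕ → Type*} [∀ A, MeasurableSpace (Ω A)] {P : ∀ A, Measure (Ω A)}
  [∀ A, IsProbabilityMeasure (P A)] {X : ∀ A, ℕ → Ω A → Fin A → ℕ}

/-- Inclusion-exclusion over the events of exceeding `x i / A` gives an alternating sum of joint
tails, each tending to `exp (-∑ i ∈ S, x i)`; the limiting sum factors as the product. -/
theorem tendsto_measureReal_forall_mul_limitShare_le
    (hX : ∀ A, IsPolyaUrn (P A) (fun (_ : Fin A) (k : ℕ) => (k : ℝ)) (fun _ => 1) (X A))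
    (A₀ : ℕ) (x : Fin A₀ → ℝ) (hx : ∀ i, 0 ≤ x i) :
    Tendsto
      (fun A : ℕ => (P A).real
        {ω | ∀ (i : Fin A₀) (hi : (i : ℕ) < A), (A : ℝ) * limitShare (X A) ⟨i, hi⟩ ω ≤ x i})
      atTop (𝓝 (∏ i, (1 - Real.exp (-x i)))) := by
  have hlim : Tendsto (fun A : ℕ => ∑ S ∈ (Finset.univ : Finset (Fin A₀)).powerset,
      (-1 : ℝ) ^ S.card * (1 - (∑ i ∈ S, x i) / A) ^ (A - 1)) atTop
      (𝓝 (∑ S ∈ (Finset.univ : Finset (Fin A₀)).powerset,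
        (-1 : ℝ) ^ S.card * Real.exp (-∑ i ∈ S, x i))) :=
    tendsto_finsetSum _ fun S _ => tendsto_const_nhds.mul (tendsto_one_sub_div_pow_pred _)
  have hval : ∑ S ∈ (Finset.univ : Finset (Fin A₀)).powerset,
      (-1 : ℝ) ^ S.card * Real.exp (-∑ i ∈ S, x i) = ∏ i, (1 - Real.exp (-x i)) := by
    simp_rw [sub_eq_add_neg]
    rw [Finset.prod_one_add]
    refine Finset.sum_congr rfl fun S _ => ?_
    rw [Finset.prod_neg, ← Real.exp_sum, Finset.sum_neg_distrib]
  rw [hval] at hlim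
  refine hlim.congr' ?_
  filter_upwards [eventually_ge_atTop A₀, eventually_gt_atTop 0,
    -- `A > ∑ i, x i` makes the thresholds sum to less than `1` for every subset `S`.
    tendsto_natCast_atTop_atTop.eventually (eventually_gt_atTop (∑ i, x i))] with A hA hA0 hAx
  have hA0' : (0 : ℝ) < A := by exact_mod_cast hA0
  set B : Fin A₀ → Set (Ω A) := fun i => {ω | x i / A < limitShare (X A) (Fin.castLE hA i) ω}
  have hset : {ω | ∀ (i : Fin A₀) (hi : (i : ℕ) < A),
      (A : ℝ) * limitShare (X A) ⟨i, hi⟩ ω ≤ x i} = {ω | ∀ i, ω ∉ B i} := by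
    ext ω
    refine forall_congr' fun i => ?_
    have hi : (i : ℕ) < A := i.2.trans_le hA
    have : ω ∉ B i ↔ (A : ℝ) * limitShare (X A) ⟨i, hi⟩ ω ≤ x i := by
      change ¬ (x i / A < limitShare (X A) (Fin.castLE hA i) ω) ↔ _
      rw [not_lt, le_div_iff₀ hA0', mul_comm]
      rfl
    rw [this]
    exact ⟨fun h => h hi, fun h _ => h⟩
  rw [hset, measureReal_forall_notMem_eq_sum B fun i =>
    measurableSet_lt_limitShare (hX A).measurable _ _]
  refine Finset.sum_congr rfl fun S _ => ?_
  set t : Fin A → ℝ := fun j => if h : (j : ℕ) < A₀ then x ⟨j, h⟩ / A else 0 with ht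
  have htc : ∀ i : Fin A₀, t (Fin.castLE hA i) = x i / A := fun i => by simp [ht]
  have hsum : ∑ j ∈ S.map (Fin.castLEEmb hA), t j = (∑ i ∈ S, x i) / A := by
    rw [Finset.sum_map, Finset.sum_div]
    exact Finset.sum_congr rfl fun i _ => htc i
  have hset' : {ω | ∀ i ∈ S, ω ∈ B i} =
      {ω | ∀ j ∈ S.map (Fin.castLEEmb hA), t j < limitShare (X A) j ω} := by
    ext ω
    simp only [Set.mem_ofPred_eq, Finset.forall_mem_map, Fin.castLEEmb_apply, htc]
    rfl
  rw [hset', (hX A).measureReal_forall_lt_limitShare hA0 _ t ?_ ?_, hsum]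
  · intro j _
    simp only [ht]
    split_ifs
    exacts [div_nonneg (hx _) hA0'.le, le_rfl]
  · rw [hsum, div_lt_one hA0']
    exact lt_of_le_of_lt
      (Finset.sum_le_sum_of_subset_of_nonneg (Finset.subset_univ S) fun i _ _ => hx i) hAx

end Sequence

end IsPolyaUrn

/-! ### Mean counts at the scale `log n / n`, and tools for uniform convergence -/

theorem tendsto_log_natCast_atTop : Tendsto (fun n : ℕ => Real.log n) atTop atTop :=
  Real.tendsto_log_atTop.comp tendsto_natCast_atTop_atTop

theorem tendsto_log_natCast_div : Tendsto (fun n : ℕ => Real.log n / n) atTop (𝓝 0) :=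
  (Real.isLittleO_log_id_atTop.tendsto_div_nhds_zero).comp tendsto_natCast_atTop_atTop

theorem tendsto_mul_one_sub_log_div_pow_zero {a : ℝ} (ha : 1 < a) :
    Tendsto (fun n : ℕ => (n : ℝ) * (1 - a * Real.log n / n) ^ (n - 1)) atTop (𝓝 0) := by
  have hbd : Tendsto (fun n : ℕ => Real.exp ((1 - a) * Real.log n + a * (Real.log n / n))) atTop
      (𝓝 0) := by
    refine Real.tendsto_exp_atBot.comp (Tendsto.atBot_add
      (C := a * 0) (tendsto_log_natCast_atTop.const_mul_atTop_of_neg (by linarith))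
      (tendsto_log_natCast_div.const_mul a))
  have hu : Tendsto (fun n : ℕ => a * Real.log n / n) atTop (𝓝 0) := by
    simpa [mul_div_assoc] using tendsto_log_natCast_div.const_mul a
  refine tendsto_of_tendsto_of_tendsto_of_le_of_le' tendsto_const_nhds hbd ?_ ?_
  · filter_upwards [hu.eventually (gt_mem_nhds one_pos)] with n hn
    exact mul_nonneg n.cast_nonneg (pow_nonneg (by linarith) _)
  · filter_upwards [hu.eventually (gt_mem_nhds one_pos), eventually_gt_atTop 0] with n hn hn0
    have hn' : (0 : ℝ) < n := by exact_mod_cast hn0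
    have h1 : (1 - a * Real.log n / n) ^ (n - 1) ≤
        Real.exp (-(a * Real.log n / n)) ^ (n - 1) :=
      pow_le_pow_left₀ (by linarith) (Real.one_sub_le_exp_neg _) _
    calc (n : ℝ) * (1 - a * Real.log n / n) ^ (n - 1)
        ≤ Real.exp (Real.log n) * Real.exp (-(a * Real.log n / n)) ^ (n - 1) := by
          rw [Real.exp_log hn']; exact mul_le_mul_of_nonneg_left h1 hn'.le
      _ = Real.exp ((1 - a) * Real.log n + a * (Real.log n / n)) := by
          rw [← Real.exp_nat_mul, ← Real.exp_add, Nat.cast_sub hn0]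
          congr 1
          field_simp
          push_cast
          ring

/-- With `v = a log n / n`, the bound `log (1 - v) ≥ -v / (1 - v)` makes the expression at least
`exp (log n * (1 - a / (1 - v)))`, and the bracket tends to `1 - a > 0`. -/
theorem tendsto_mul_one_sub_log_div_pow_atTop {a : ℝ} (ha0 : 0 ≤ a) (ha : a < 1) :
    Tendsto (fun n : ℕ => (n : ℝ) * (1 - a * Real.log n / n) ^ (n - 1)) atTop atTop := by
  have hu : Tendsto (fun n : ℕ => a * Real.log n / n) atTop (𝓝 0) := by
    simpa [mul_div_assoc] using tendsto_log_natCast_div.const_mul a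
  have hbr : Tendsto (fun n : ℕ => 1 - a / (1 - a * Real.log n / n)) atTop (𝓝 (1 - a / (1 - 0))) :=
    tendsto_const_nhds.sub (tendsto_const_nhds.div (tendsto_const_nhds.sub hu) (by norm_num))
  have hbd : Tendsto (fun n : ℕ => Real.exp (Real.log n * (1 - a / (1 - a * Real.log n / n)))) atTop
      atTop :=
    Real.tendsto_exp_atTop.comp
      (tendsto_log_natCast_atTop.atTop_mul_pos (by norm_num; linarith) hbr)
  refine tendsto_atTop_mono' _ ?_ hbd
  filter_upwards [hu.eventually (gt_mem_nhds one_pos), eventually_gt_atTop 0] with n hn hn0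
  have hn' : (0 : ℝ) < n := by exact_mod_cast hn0
  have hL : 0 ≤ Real.log n := Real.log_natCast_nonneg n
  set v := a * Real.log n / n with hv
  have hv0 : 0 ≤ v := by positivity
  have hv1 : 0 < 1 - v := by linarith
  calc Real.exp (Real.log n * (1 - a / (1 - v)))
      ≤ Real.exp (Real.log n + n * Real.log (1 - v)) := by
        refine Real.exp_le_exp.2 ?_
        have h1 := mul_le_mul_of_nonneg_left (Real.one_sub_inv_le_log_of_pos hv1) hn'.le
        refine le_trans (le_of_eq ?_) (add_le_add_right h1 _)
        have h2 : (n : ℝ) * v = a * Real.log n := by rw [hv]; field_simp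
        have h3 : 1 - (1 - v)⁻¹ = -v / (1 - v) := by field_simp; ring
        rw [h3, mul_div_assoc', mul_neg, h2]
        ring
    _ = n * (1 - v) ^ n := by
        rw [Real.exp_add, Real.exp_log hn', Real.exp_nat_mul, Real.exp_log hv1]
    _ ≤ n * (1 - v) ^ (n - 1) :=
        mul_le_mul_of_nonneg_left
          (pow_le_pow_of_le_one hv1.le (by linarith) (Nat.sub_le _ _)) hn'.le

/-- A quantitative Glivenko–Cantelli bound: closeness to the exponential tail at the points
`-log (1 - k / M)` implies uniform closeness. -/
theorem abs_sub_exp_neg_le {F : ℝ → ℝ} (hF : Antitone F) (h0 : ∀ x, 0 ≤ F x) (h1 : ∀ x, F x ≤ 1)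
    {M : ℕ} {η : ℝ} (hη : 0 ≤ η)
    (h : ∀ k ∈ Finset.Ico 1 M, |F (-Real.log (1 - (k : ℝ) / M)) - (1 - (k : ℝ) / M)| ≤ η)
    (hM : 0 < M) {x : ℝ} (hx : 0 ≤ x) : |F x - Real.exp (-x)| ≤ 1 / M + η := by
  have hM' : (0 : ℝ) < M := by exact_mod_cast hM
  set y := Real.exp (-x) with hy
  have hy0 : 0 < y := Real.exp_pos _
  have hy1 : y ≤ 1 := Real.exp_le_one_iff.2 (by linarith)
  have hlog : Real.log y = -x := Real.log_exp _
  -- This `j` gives `1 - (j + 1) / M < y ≤ 1 - j / M`, so `x` lies between two neighbouring grid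
  -- points. At the ends, `j = 0` and `j + 1 = M`, the bounds `0 ≤ F ≤ 1` replace the grid
  -- hypothesis.
  set j := ⌊M * (1 - y)⌋₊ with hj
  have hj1 : (j : ℝ) ≤ M * (1 - y) := Nat.floor_le (mul_nonneg hM'.le (by linarith))
  have hj2 : M * (1 - y) < j + 1 := Nat.lt_floor_add_one _
  have hjM : j < M := by
    have : (j : ℝ) < M := lt_of_le_of_lt hj1 (by nlinarith)
    exact_mod_cast this
  have hj1' : y ≤ 1 - (j : ℝ) / M := by
    have : (j : ℝ) / M ≤ 1 - y := by rw [div_le_iff₀ hM']; linarith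
    linarith
  have hj2' : 1 - ((j + 1 : ℕ) : ℝ) / M < y := by
    have : 1 - y < ((j + 1 : ℕ) : ℝ) / M := by rw [lt_div_iff₀ hM']; push_cast; linarith
    linarith
  have hstep : ((j + 1 : ℕ) : ℝ) / M = (j : ℝ) / M + 1 / M := by push_cast; rw [add_div]
  rw [abs_sub_le_iff]
  constructor
  · have : F x ≤ 1 - (j : ℝ) / M + η := by
      rcases Nat.eq_zero_or_pos j with hj0 | hj0
      · rw [hj0]; simp; linarith [h1 x]
      · have hk := (abs_sub_le_iff.1 (h j (Finset.mem_Ico.2 ⟨hj0, hjM⟩))).1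
        have hxj : -Real.log (1 - (j : ℝ) / M) ≤ x := by
          have := Real.log_le_log hy0 hj1'
          linarith
        linarith [hF hxj]
    linarith
  · have : 1 - ((j + 1 : ℕ) : ℝ) / M - η ≤ F x := by
      rcases (Nat.succ_le_of_lt hjM).eq_or_lt with hjj | hjj
      · have : j + 1 = M := hjj
        rw [this, div_self hM'.ne']; linarith [h0 x]
      · have hk := (abs_sub_le_iff.1 (h (j + 1) (Finset.mem_Ico.2 ⟨by omega, hjj⟩))).2
        have hpos : 0 < 1 - ((j + 1 : ℕ) : ℝ) / M := by
          rw [sub_pos, div_lt_one hM']; exact_mod_cast hjj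
        have hxj : x ≤ -Real.log (1 - ((j + 1 : ℕ) : ℝ) / M) := by
          have := Real.log_le_log hpos hj2'.le
          linarith
        linarith [hF hxj]
    linarith

/-- Reduces an uncountable supremum to a countable one, for measurability. By right-continuity, a
value above the rational supremum would persist on some `[x, u)`, which contains a rational. -/
theorem ciSup_Ici_eq_ciSup_rat {g : ℝ → ℝ} {C : ℝ} (hC : ∀ x, 0 ≤ x → g x ≤ C)
    (hg : ∀ x, ContinuousWithinAt g (Set.Ici x) x) :
    ⨆ x : Set.Ici (0 : ℝ), g x = ⨆ q : {q : ℚ // 0 ≤ q}, g (q : ℚ) := by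
  have : Nonempty {q : ℚ // 0 ≤ q} := ⟨⟨0, le_rfl⟩⟩
  have hb1 : BddAbove (Set.range fun x : Set.Ici (0 : ℝ) => g x) :=
    ⟨C, by rintro _ ⟨x, rfl⟩; exact hC _ x.2⟩
  have hb2 : BddAbove (Set.range fun q : {q : ℚ // 0 ≤ q} => g (q : ℚ)) :=
    ⟨C, by rintro _ ⟨q, rfl⟩; exact hC _ (by exact_mod_cast q.2)⟩
  refine le_antisymm (ciSup_le fun x => ?_) (ciSup_le fun q => ?_)
  · by_contra! hlt
    have h1 : ∀ᶠ y in 𝓝[≥] (x : ℝ), (⨆ q : {q : ℚ // 0 ≤ q}, g (q : ℚ)) < g y :=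
      (hg x).eventually (lt_mem_nhds hlt)
    obtain ⟨u, hu, hsub⟩ := mem_nhdsGE_iff_exists_Ico_subset.1 h1
    obtain ⟨q, hq1, hq2⟩ := exists_rat_btwn (show (x : ℝ) < u from hu)
    have hq0 : (0 : ℚ) ≤ q := by
      have : (0 : ℝ) ≤ q := le_trans x.2 hq1.le
      exact_mod_cast this
    exact absurd (le_ciSup hb2 ⟨q, hq0⟩) (not_le.2 (hsub ⟨hq1.le, hq2⟩))
  · exact le_ciSup hb1 ⟨(q : ℚ), by
      have : (0 : ℝ) ≤ ((q : ℚ) : ℝ) := by exact_mod_cast q.2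
      exact this⟩

theorem continuousWithinAt_ite_lt (a x : ℝ) :
    ContinuousWithinAt (fun y : ℝ => if y < a then (1 : ℝ) else 0) (Set.Ici x) x := by
  by_cases h : x < a
  · refine ContinuousAt.continuousWithinAt ?_
    refine (continuousAt_const (y := (1 : ℝ))).congr ?_
    filter_upwards [gt_mem_nhds h] with y hy
    simp [hy]
  · refine (continuousWithinAt_const (b := (0 : ℝ))).congr (fun y hy => ?_) (by simp [h])
    have : ¬ y < a := not_lt.2 ((not_lt.1 h).trans hy)
    simp [this]

/-! ### The maximal share and the empirical distribution -/

namespace IsPolyaUrn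

variable {Ω : ℕ → Type*} [∀ A, MeasurableSpace (Ω A)] {P : ∀ A, Measure (Ω A)}
  [∀ A, IsProbabilityMeasure (P A)] {X : ∀ A, ℕ → Ω A → Fin A → ℕ}

/-- A maximum that is too large is excluded by the union bound at level `a log A / A` with `a > 1`.
One that is too small forces the count at level `b log A / A`, `b < 1`, to be zero although its mean
`q` tends to infinity. -/
theorem tendstoInDistribution_max
    (hX : ∀ A, IsPolyaUrn (P A) (fun (_ : Fin A) (k : ℕ) => (k : ℝ)) (fun _ => 1) (X A)) :
    TendstoInDistribution
      (fun (A : ℕ) (ω : Ω A) => (A : ℝ) / Real.log A * ⨆ i : Fin A, limitShare (X A) i ω)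
      atTop (fun _ : Unit => (1 : ℝ)) P (Measure.dirac ()) := by
  refine tendstoInDistribution_of_tendsto_measureReal P _ 1 (fun A => ?_) fun ε hε => ?_
  · exact (Measurable.iSup fun i => measurable_limitShare (hX A).measurable i).const_mul _
  set a := 1 + ε / 2 with ha
  -- The minimum keeps `b` nonnegative when `ε` is large.
  set b := 1 - min (ε / 2) (1 / 2) with hb
  have hb1 : b < 1 := by
    have : 0 < min (ε / 2) (1 / 2) := lt_min (by linarith) (by norm_num)
    linarith
  have hb0 : 0 ≤ b := by linarith [min_le_right (ε / 2) (1 / 2)]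
  have hbε : 1 - ε < b := by linarith [min_le_left (ε / 2) (1 / 2)]
  have hup := tendsto_mul_one_sub_log_div_pow_zero (a := a) (by linarith)
  have hlo := (tendsto_mul_one_sub_log_div_pow_atTop hb0 hb1)
  have hlim : Tendsto (fun n : ℕ => (n : ℝ) * (1 - a * Real.log n / n) ^ (n - 1) +
      ((n : ℝ) * (1 - b * Real.log n / n) ^ (n - 1))⁻¹) atTop (𝓝 0) := by
    simpa using hup.add hlo.inv_tendsto_atTop
  have hu : ∀ c : ℝ, Tendsto (fun n : ℕ => c * Real.log n / n) atTop (𝓝 0) := fun c => by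
    simpa [mul_div_assoc] using tendsto_log_natCast_div.const_mul c
  refine tendsto_of_tendsto_of_tendsto_of_le_of_le' tendsto_const_nhds hlim
    (Eventually.of_forall fun _ => measureReal_nonneg) ?_
  filter_upwards [(hu a).eventually (gt_mem_nhds one_pos),
    (hu b).eventually (gt_mem_nhds (show (0 : ℝ) < 1 / 2 by norm_num)), eventually_gt_atTop 1,
    hlo.eventually (eventually_gt_atTop 0)] with A hAa hAb hA1 hApos
  have hA : 0 < A := by omega
  have hA' : (0 : ℝ) < A := by exact_mod_cast hA
  have hL : 0 < Real.log A := Real.log_pos (by exact_mod_cast hA1)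
  have : Nonempty (Fin A) := ⟨⟨0, hA⟩⟩
  set u := a * Real.log A / A with hu'
  set v := b * Real.log A / A with hv'
  have hu0 : 0 ≤ u := by positivity
  have hv0 : 0 ≤ v := by positivity
  set q := (A : ℝ) * (1 - v) ^ (A - 1) with hq
  have hsub : {ω | ε ≤ |(A : ℝ) / Real.log A * (⨆ i : Fin A, limitShare (X A) i ω) - 1|} ⊆
      (⋃ i, {ω | u < limitShare (X A) i ω}) ∪ {ω | q ≤ |exceedCount (X A) v ω - q|} := by
    intro ω hω
    have hω' : ε ≤ |(A : ℝ) / Real.log A * (⨆ i : Fin A, limitShare (X A) i ω) - 1| := hω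
    have hmul : ∀ c y : ℝ, c < A / Real.log A * y ↔ c * Real.log A / A < y := fun c y => by
      rw [div_mul_eq_mul_div, lt_div_iff₀ hL, div_lt_iff₀ hA', mul_comm y]
    rcases le_abs.1 hω' with h | h
    · refine Or.inl (Set.mem_iUnion.2 ?_)
      obtain ⟨i, hi⟩ := exists_eq_ciSup_of_finite (f := fun i => limitShare (X A) i ω)
      refine ⟨i, ?_⟩
      change u < limitShare (X A) i ω
      rw [hi, hu', ← hmul]
      linarith
    · refine Or.inr ?_
      have hle : ⨆ i, limitShare (X A) i ω ≤ v := by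
        rw [← not_lt, hv', ← hmul]
        linarith
      have h0 : exceedCount (X A) v ω = 0 := Finset.sum_eq_zero fun i _ => by
        refine Set.indicator_of_notMem (fun hi => ?_) _
        exact absurd (lt_of_lt_of_le hi (le_ciSup (Set.finite_range _).bddAbove i)) (not_lt.2 hle)
      change q ≤ |exceedCount (X A) v ω - q|
      rw [h0, zero_sub, abs_neg]
      exact le_abs_self q
  refine (measureReal_mono hsub).trans ((measureReal_union_le _ _).trans (add_le_add ?_ ?_))
  · refine (measureReal_iUnion_fintype_le _).trans (le_of_eq ?_)
    have h1 : ∀ i, (P A).real {ω | u < limitShare (X A) i ω} = (1 - u) ^ (A - 1) := fun i => by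
      have := (hX A).measureReal_forall_lt_limitShare hA {i} (fun _ => u) (fun _ _ => hu0)
        (by simpa using hAa)
      simpa using this
    simp [h1]
  -- Chebyshev with deviation equal to the mean `q` gives `q / q ^ 2 = q⁻¹`.
  · refine ((hX A).measureReal_le_abs_exceedCount_sub hA hv0 (by linarith) hApos).trans (le_of_eq ?_)
    rw [← hq, sq, div_mul_cancel_left₀ hApos.ne']

/-- Eventually the normalised mean is within `η / 2` of `exp (-x)`, so the count must deviate from
its mean by `A η / 2`; Chebyshev bounds this by `A / (A η / 2)² = 4 / (η² A)`. -/
theorem tendsto_measureReal_le_abs_exceedCount_div_sub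
    (hX : ∀ A, IsPolyaUrn (P A) (fun (_ : Fin A) (k : ℕ) => (k : ℝ)) (fun _ => 1) (X A))
    {x : ℝ} (hx : 0 ≤ x) {η : ℝ} (hη : 0 < η) :
    Tendsto (fun A => (P A).real {ω | η ≤ |1 / (A : ℝ) * exceedCount (X A) (x / A) ω -
      Real.exp (-x)|}) atTop (𝓝 0) := by
  have hp := tendsto_one_sub_div_pow_pred x
  have hxA : Tendsto (fun n : ℕ => x / (n : ℝ)) atTop (𝓝 0) :=
    tendsto_const_nhds.div_atTop tendsto_natCast_atTop_atTop
  have hlim : Tendsto (fun A : ℕ => 4 / η ^ 2 / (A : ℝ)) atTop (𝓝 0) :=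
    tendsto_const_nhds.div_atTop tendsto_natCast_atTop_atTop
  refine tendsto_of_tendsto_of_tendsto_of_le_of_le' tendsto_const_nhds hlim
    (Eventually.of_forall fun _ => measureReal_nonneg) ?_
  filter_upwards [hp.eventually (Metric.ball_mem_nhds _ (half_pos hη)), eventually_gt_atTop 0,
    hxA.eventually (gt_mem_nhds (show (0 : ℝ) < 1 / 2 by norm_num))] with A hpA hA hxA
  have hA' : (0 : ℝ) < A := by exact_mod_cast hA
  have hx0 : 0 ≤ x / A := by positivity
  have hle : (P A).real {ω | η ≤ |1 / (A : ℝ) * exceedCount (X A) (x / A) ω - Real.exp (-x)|} ≤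
      (P A).real {ω | A * (η / 2) ≤
        |exceedCount (X A) (x / A) ω - A * (1 - x / A) ^ (A - 1)|} := by
    refine measureReal_mono fun ω hω => ?_
    have hω' : η ≤ |1 / (A : ℝ) * exceedCount (X A) (x / A) ω - Real.exp (-x)| := hω
    have hpA' : |(1 - x / A) ^ (A - 1) - Real.exp (-x)| < η / 2 := hpA
    have h1 := abs_sub_le (1 / (A : ℝ) * exceedCount (X A) (x / A) ω) ((1 - x / A) ^ (A - 1))
      (Real.exp (-x))
    change A * (η / 2) ≤ |exceedCount (X A) (x / A) ω - A * (1 - x / A) ^ (A - 1)|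
    have h2 : exceedCount (X A) (x / A) ω - A * (1 - x / A) ^ (A - 1) =
        A * (1 / (A : ℝ) * exceedCount (X A) (x / A) ω - (1 - x / A) ^ (A - 1)) := by
      field_simp
    rw [h2, abs_mul, abs_of_pos hA']
    exact mul_le_mul_of_nonneg_left (by linarith) hA'.le
  refine hle.trans (((hX A).measureReal_le_abs_exceedCount_sub hA hx0 (by linarith)
    (by positivity)).trans ?_)
  have hp1 : (1 - x / A) ^ (A - 1) ≤ 1 := pow_le_one₀ (by linarith) (by linarith)
  calc A * (1 - x / A) ^ (A - 1) / (A * (η / 2)) ^ 2 ≤ A * 1 / (A * (η / 2)) ^ 2 := by gcongr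
    _ = 4 / η ^ 2 / A := by field_simp; norm_num

theorem tendstoInDistribution_empirical
    (hX : ∀ A, IsPolyaUrn (P A) (fun (_ : Fin A) (k : ℕ) => (k : ℝ)) (fun _ => 1) (X A)) :
    TendstoInDistribution
      (fun (A : ℕ) (ω : Ω A) => ⨆ x : Set.Ici (0 : ℝ),
        |1 / (A : ℝ) * ∑ i : Fin A,
            (if (x : ℝ) < (A : ℝ) * limitShare (X A) i ω then (1 : ℝ) else 0)
          - Real.exp (-(x : ℝ))|)
      atTop (fun _ : Unit => (0 : ℝ)) P (Measure.dirac ()) := by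
  set F : ∀ A, Ω A → ℝ → ℝ := fun A ω x => 1 / (A : ℝ) * ∑ i : Fin A,
    (if x < (A : ℝ) * limitShare (X A) i ω then (1 : ℝ) else 0) with hF
  have hF0 : ∀ A ω x, 0 ≤ F A ω x := fun A ω x =>
    mul_nonneg (by positivity) (Finset.sum_nonneg fun i _ => by split_ifs <;> norm_num)
  have hF1 : ∀ A ω x, F A ω x ≤ 1 := fun A ω x => by
    have h1 : ∑ i : Fin A, (if x < (A : ℝ) * limitShare (X A) i ω then (1 : ℝ) else 0) ≤ A := by
      refine (Finset.sum_le_sum (g := fun _ => (1 : ℝ)) fun i _ => ?_).trans (by simp)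
      split_ifs <;> norm_num
    simp only [hF]
    rw [one_div_mul_eq_div]
    exact div_le_one_of_le₀ h1 (Nat.cast_nonneg _)
  have hFanti : ∀ A ω, Antitone (F A ω) := fun A ω x y hxy =>
    mul_le_mul_of_nonneg_left (Finset.sum_le_sum fun i _ => by
      split_ifs with h1 h2
      exacts [le_rfl, absurd (hxy.trans_lt h1) h2, zero_le_one, le_rfl]) (by positivity)
  have hFcont : ∀ A ω x, ContinuousWithinAt (F A ω) (Set.Ici x) x := fun A ω x =>
    continuousWithinAt_const.mul
      (tendsto_finsetSum _ fun i _ => continuousWithinAt_ite_lt _ x)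
  have hFmeas : ∀ A x, Measurable fun ω => F A ω x := fun A x =>
    (Finset.measurable_sum _ fun i _ => Measurable.ite
      (measurableSet_lt measurable_const ((measurable_limitShare (hX A).measurable i).const_mul _))
      measurable_const measurable_const).const_mul _
  have hFcount : ∀ A : ℕ, 0 < A → ∀ ω x,
      F A ω x = 1 / (A : ℝ) * exceedCount (X A) (x / A) ω := fun A hA ω x => by
    have hA' : (0 : ℝ) < A := by exact_mod_cast hA
    simp only [hF, exceedCount]
    congr 1
    refine Finset.sum_congr rfl fun i _ => ?_
    simp only [Set.indicator_apply, Set.mem_ofPred_eq, div_lt_iff₀ hA', Pi.one_apply, mul_comm]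
  refine tendstoInDistribution_of_tendsto_measureReal P _ 0 (fun A => ?_) fun ε hε => ?_
  -- Measurability: the supremum may be taken over nonnegative rationals.
  · have : (fun ω => ⨆ x : Set.Ici (0 : ℝ), |F A ω x - Real.exp (-(x : ℝ))|) =
        fun ω => ⨆ q : {q : ℚ // 0 ≤ q}, |F A ω (q : ℚ) - Real.exp (-((q : ℚ) : ℝ))| := by
      refine funext fun ω => ciSup_Ici_eq_ciSup_rat (C := 1)
        (g := fun x => |F A ω x - Real.exp (-x)|) (fun x hx => ?_) fun x => ?_
      · have h1 : Real.exp (-x) ≤ 1 := Real.exp_le_one_iff.2 (by linarith)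
        exact abs_sub_le_iff.2 ⟨by linarith [hF1 A ω x, Real.exp_pos (-x)],
          by linarith [hF0 A ω x]⟩
      · exact ((hFcont A ω x).sub (by fun_prop)).abs
    exact this ▸ Measurable.iSup fun q => ((hFmeas A _).sub_const _).abs
  obtain ⟨M, hM⟩ := exists_nat_one_div_lt (half_pos hε)
  -- Grid error `1 / (M + 1) < ε / 2` plus `η` stays below `ε`.
  set η := ε / 4 with hη
  have hη0 : 0 < η := by positivity
  have hlim : Tendsto (fun A => ∑ k ∈ Finset.Ico 1 (M + 1), (P A).real
      {ω | η ≤ |F A ω (-Real.log (1 - (k : ℝ) / (M + 1 : ℕ))) - (1 - (k : ℝ) / (M + 1 : ℕ))|}) atTop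
      (𝓝 0) := by
    rw [← Finset.sum_const_zero (s := Finset.Ico 1 (M + 1))]
    refine tendsto_finsetSum _ fun k hk => ?_
    have hk' := Finset.mem_Ico.1 hk
    have hM0 : (0 : ℝ) < (M + 1 : ℕ) := by positivity
    have hpos : 0 < 1 - (k : ℝ) / (M + 1 : ℕ) := by
      rw [sub_pos, div_lt_one hM0]; exact_mod_cast hk'.2
    have hle : 1 - (k : ℝ) / (M + 1 : ℕ) ≤ 1 := by
      have : (0 : ℝ) ≤ (k : ℝ) / (M + 1 : ℕ) := by positivity
      linarith
    have h := tendsto_measureReal_le_abs_exceedCount_div_sub hX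
      (x := -Real.log (1 - (k : ℝ) / (M + 1 : ℕ)))
      (neg_nonneg.2 (Real.log_nonpos hpos.le hle)) hη0
    rw [neg_neg, Real.exp_log hpos] at h
    refine h.congr' ?_
    filter_upwards [eventually_gt_atTop 0] with A hA
    simp_rw [hFcount A hA]
  refine tendsto_of_tendsto_of_tendsto_of_le_of_le tendsto_const_nhds hlim
    (fun _ => measureReal_nonneg) fun A => ?_
  refine le_trans (measureReal_mono (fun ω hω => ?_) (measure_ne_top _ _))
    (measureReal_biUnion_finset_le _ _)
  -- If no grid point is bad, `abs_sub_exp_neg_le` bounds the whole supremum by less than `ε`.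
  by_contra hnot
  simp only [Set.mem_iUnion, not_exists] at hnot
  have hbd : ∀ x : Set.Ici (0 : ℝ), |F A ω x - Real.exp (-(x : ℝ))| ≤ 1 / (M + 1 : ℕ) + η := fun x =>
    abs_sub_exp_neg_le (hFanti A ω) (hF0 A ω) (hF1 A ω) hη0.le
      (fun k hk => (not_le.1 (hnot k hk)).le) M.succ_pos x.2
  have hω' : ε ≤ |(⨆ x : Set.Ici (0 : ℝ), |F A ω x - Real.exp (-(x : ℝ))|) - 0| := hω
  rw [sub_zero, abs_of_nonneg (Real.iSup_nonneg fun x => abs_nonneg _)] at hω'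
  have := ciSup_le hbd
  push_cast at this
  linarith

end IsPolyaUrn

theorem mainTheorem12
    {Ω : ℕ → Type*} [∀ A, MeasurableSpace (Ω A)]
    (P : ∀ A, Measure (Ω A)) [∀ A, IsProbabilityMeasure (P A)]
    (X : ∀ A, ℕ → Ω A → Fin A → ℕ)
    (hX : ∀ A, IsPolyaUrn (P A) (fun (_ : Fin A) (k : ℕ) => (k : ℝ)) (fun _ => 1) (X A)) :
    -- the long-time shares exist almost surely, as numbers in `[0, 1]`
    (∀ A, ∀ᵐ ω ∂(P A), ∀ i : Fin A,
      Tendsto (fun n => share (X A) i n ω) atTop (𝓝 (limitShare (X A) i ω)) ∧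
        limitShare (X A) i ω ∈ Set.Icc (0 : ℝ) 1) ∧
    -- joint convergence of the rescaled shares of the first `A₀` agents (which exist once `A₀ ≤ A`)
    (∀ (A₀ : ℕ) (x : Fin A₀ → ℝ), (∀ i, 0 < x i) →
      Tendsto
        (fun A : ℕ => (P A).real
          {ω | ∀ (i : Fin A₀) (hi : (i : ℕ) < A), (A : ℝ) * limitShare (X A) ⟨i, hi⟩ ω ≤ x i})
        atTop (𝓝 (∏ i, (1 - Real.exp (-x i))))) ∧
    -- the maximal share
    TendstoInDistribution
      (fun (A : ℕ) (ω : Ω A) => (A : ℝ) / Real.log A * ⨆ i : Fin A, limitShare (X A) i ω)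
      atTop (fun _ : Unit => (1 : ℝ)) P (Measure.dirac ()) ∧
    -- the empirical distribution of the rescaled shares
    TendstoInDistribution
      (fun (A : ℕ) (ω : Ω A) => ⨆ x : Set.Ici (0 : ℝ),
        |1 / (A : ℝ) * ∑ i : Fin A,
            (if (x : ℝ) < (A : ℝ) * limitShare (X A) i ω then (1 : ℝ) else 0)
          - Real.exp (-(x : ℝ))|)
      atTop (fun _ : Unit => (0 : ℝ)) P (Measure.dirac ()) := by
  refine ⟨fun A => ?_, fun A₀ x hx => ?_, IsPolyaUrn.tendstoInDistribution_max hX,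
    IsPolyaUrn.tendstoInDistribution_empirical hX⟩
  · filter_upwards [(hX A).ae_tendsto_share] with ω hω i
    exact ⟨hω i, IsPolyaUrn.limitShare_mem_Icc (hω i)⟩
  · exact IsPolyaUrn.tendsto_measureReal_forall_mul_limitShare_le hX A₀ x fun i => (hx i).le
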